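/- Let $p$ be an odd prime and let $\mathcal Q(p)$ be the universal Steenrod algebra at $p$, i.e. the unital associative $\mathbb F_p$-algebra generated by the symbols $z_{\epsilon,k}$, $(\epsilon,k)\in\{0,1\}\times\mathbb Z$, subject to the relations $R(\epsilon,k,n)=0$ and $S(\epsilon,k,n)=0$ for $\epsilon\in\{0,1\}$, $k\in\mathbb Z$, $n\in\mathbb N_0$, where $$R(\epsilon,k,n)=z_{\epsilon,pk-1-n}z_{0,k}+\sum_{j\ge 0}(-1)^j\binom{(p-1)(n-j)-1}{j}z_{\epsilon,pk-1-j}z_{0,k-n+j},$$ $$S(\epsilon,k,n)=z_{\epsilon,pk-n}z_{1,k}+\sum_{j\ge 0}(-1)^{j}\binom{(p-1)(n-j)-1}{j}z_{\epsilon,pk-j}z_{1,k-n+j}+(1-\epsilon)\sum_{j\ge 0}(-1)^{j+1}\binom{(p-1)(n-j)}{j}z_{1,pk-j}z_{0,k-n+j},$$ and $\binom{l}{r}=0$ whenever $l<0$ or $0\le l<r$. A monomial $z_{\epsilon_1,i_1}\cdots z_{\epsilon_m,i_m}$ (with its label $(\epsilon_1,i_1;\dots;\epsilon_m,i_m)$)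 is called admissible if $i_j\ge p\,i_{j+1}+\epsilon_{j+1}$ for $1\le j\le m-1$; the empty monomial $1$ is admissible. For $s\in\mathbb N_0$ put $\alpha_s=\frac{p^s-1}{p-1}$, and let $\mathcal Q^0_s\subseteq\mathcal Q(p)$ be the subalgebra generated by $1$ and the elements $z_{0,p^sm-\alpha_s}$, $m\in\mathbb Z$. Then: 1. The monic admissible monomials $z_{0,p^sh_1-\alpha_s}\cdots z_{0,p^sh_m-\alpha_s}$ ($m\ge 0$, $h_1,\dots,h_m\in\mathbb Z$) in these generators, indexed by their labels, form an $\mathbb F_p$-linear basis of $\mathcal Q^0_s$. 2. $\mathcal Q^0_s$ is, via the obvious map on generators, the $\mathbb F_p$-algebra presented by the generators $z_{0,p^sm-\alpha_s}$, $m\in\mathbb Z$, and the relations $R(0,p^sh-\alpha_s,p^sn)=0$, $h\in\mathbb Z$, $n\in\mathbb N_0$ (so the same monomials form a basis of the presented algebra). 3. A monomial $z_{0,p^sh_1-\alpha_s}\cdots z_{0,p^sh_m-\alpha_s}$ is admissible if and only if $h_i\ge p\,h_{i+1}$ for all $1\le i\le m-1$. -/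

import Mathlib

namespace UnivSteenrod

/-- The binomial coefficient with the usual conventions for integer upper index:
it vanishes when the upper index is negative or smaller than the lower one. -/
def binom (a : ℤ) (j : ℕ) : ℕ := if 0 ≤ a then a.toNat.choose j else 0

/-- The index set of the generators `z_{ε,k}`, i.e. of pairs `(ε, k)` in `{0,1} × ℤ`. -/
abbrev Index : Type := Fin 2 × ℤ

/-- The free unital associative `𝔽_p`-algebra on the symbols `z_{ε,k}`. -/
abbrev Free (p : ℕ) : Type := FreeAlgebra (ZMod p) Index

/-- The generator `z_{ε,k}` of the free algebra. -/
def zFree (p : ℕ) (ε : Fin 2) (k : ℤ) : Free p := FreeAlgebra.ι (ZMod p) (ε, k)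

/-- The generalized Adem polynomial `R(ε,k,n)`. All terms with `j > n` have coefficient zero
because the upper index of the binomial coefficient is negative. -/
def relR (p : ℕ) (ε : Fin 2) (k : ℤ) (n : ℕ) : Free p :=
  zFree p ε (p * k - 1 - n) * zFree p 0 k
    + ∑ j ∈ Finset.range (n + 1),
        ((-1 : ZMod p) ^ j * (binom (((p : ℤ) - 1) * ((n : ℤ) - j) - 1) j : ZMod p)) •
          (zFree p ε (p * k - 1 - j) * zFree p 0 (k - n + j))

/-- The generalized Adem polynomial `S(ε,k,n)`. Again all terms with `j > n` vanish.
The sign `(-1)^j` in the first sum is the one of the Adem relation for `P^a β P^b`, e.g.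
`P^1 β P^1 = β P^2 + P^2 β` at `p = 3`. -/
def relS (p : ℕ) (ε : Fin 2) (k : ℤ) (n : ℕ) : Free p :=
  zFree p ε (p * k - n) * zFree p 1 k
    + ∑ j ∈ Finset.range (n + 1),
        ((-1 : ZMod p) ^ j * (binom (((p : ℤ) - 1) * ((n : ℤ) - j) - 1) j : ZMod p)) •
          (zFree p ε (p * k - j) * zFree p 1 (k - n + j))
    + (1 - (ε.val : ZMod p)) •
        ∑ j ∈ Finset.range (n + 1),
          ((-1 : ZMod p) ^ (j + 1) * (binom (((p : ℤ) - 1) * ((n : ℤ) - j)) j : ZMod p)) •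
            (zFree p 1 (p * k - j) * zFree p 0 (k - n + j))

/-- The generalized Adem relations `R(ε,k,n) = 0` and `S(ε,k,n) = 0`. -/
inductive Adem (p : ℕ) : Free p → Free p → Prop
  | ofR (ε : Fin 2) (k : ℤ) (n : ℕ) : Adem p (relR p ε k n) 0
  | ofS (ε : Fin 2) (k : ℤ) (n : ℕ) : Adem p (relS p ε k n) 0

/-- The universal Steenrod algebra `Q(p)` (for `p` an odd prime). -/
abbrev Q (p : ℕ) : Type := RingQuot (Adem p)

/-- The generator `z_{ε,k}` of `Q(p)`, for `x = (ε, k)`. -/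
noncomputable def z (p : ℕ) (x : Index) : Q p :=
  RingQuot.mkAlgHom (ZMod p) (Adem p) (zFree p x.1 x.2)

/-- A label `(ε₁,i₁; …; ε_m,i_m)` is admissible if `i_j ≥ p i_{j+1} + ε_{j+1}` for all `j < m`;
the empty label is admissible. -/
def Admissible (p : ℕ) (I : List Index) : Prop :=
  I.IsChain fun x y => x.2 ≥ p * y.2 + (y.1.val : ℤ)

/-- `α_s = (p^s - 1) / (p - 1)` (an exact division when `p ≥ 2`). -/
def alpha (p s : ℕ) : ℕ := (p ^ s - 1) / (p - 1)

/-- The index `(0, p^s m - α_s)`. -/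
def idx (p s : ℕ) (m : ℤ) : Index := (0, (p : ℤ) ^ s * m - alpha p s)

/-- The set of indices of the generators `z_{0, p^s m - α_s}`, `m ∈ ℤ`. -/
def T (p s : ℕ) : Set Index := Set.range (idx p s)

/-- The subalgebra of `Q(p)` generated by `1` and the `z_{0, p^s m - α_s}`, `m ∈ ℤ`. -/
noncomputable def Q0 (p s : ℕ) : Subalgebra (ZMod p) (Q p) :=
  Algebra.adjoin (ZMod p) (z p '' T p s)

/-- The inclusion of the free algebra on the `z_{0, p^s m - α_s}` into the free algebra on all
the `z_{ε,k}`. -/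
noncomputable def inclFree (p s : ℕ) : FreeAlgebra (ZMod p) (T p s) →ₐ[ZMod p] Free p :=
  FreeAlgebra.lift (ZMod p) fun x => zFree p x.1.1 x.1.2

/-- The relations `R(0, p^s h - α_s, p^s n) = 0`, as relations between polynomials in the
generators `z_{0, p^s m - α_s}` only. -/
inductive Adem0 (p s : ℕ) :
    FreeAlgebra (ZMod p) (T p s) → FreeAlgebra (ZMod p) (T p s) → Prop
  | mk (f : FreeAlgebra (ZMod p) (T p s)) (h : ℤ) (n : ℕ)
      (hf : inclFree p s f = relR p 0 ((p : ℤ) ^ s * h - alpha p s) (p ^ s * n)) : Adem0 p s f 0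

/-- The `𝔽_p`-algebra presented by the generators `z_{0, p^s m - α_s}`, `m ∈ ℤ`, and the
relations `R(0, p^s h - α_s, p^s n) = 0`, `h ∈ ℤ`, `n ≥ 0`. -/
abbrev Q0Pres (p s : ℕ) : Type := RingQuot (Adem0 p s)

/-- The generators of the presented algebra. -/
noncomputable def zPres (p s : ℕ) (x : T p s) : Q0Pres p s :=
  RingQuot.mkAlgHom (ZMod p) (Adem0 p s) (FreeAlgebra.ι (ZMod p) x)

/-- The admissible labels of monomials in the generators `z_{0, p^s m - α_s}`. -/
abbrev AdmLabel (p s : ℕ) : Type :=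
  {I : List (T p s) // Admissible p (I.map Subtype.val)}

end UnivSteenrod

/-!
In terms of `w_h = z_{0, p^s h - α_s}`, Lucas' congruence turns the relation
`R(0, p^s h - α_s, p^s n)` into the relation `R(0, h, n)` between the `w_h` (`relR_idx`). So both the
subalgebra `Q0 p s` and the presented algebra are generated by a family satisfying the Adem
relations, and in every such algebra the admissible monomials span
(`SatisfiesAdem.prod_mem_span`): rewriting increases the moment of a label and keeps it bounded.
Everything then follows once the admissible monomials in the `z_{0,h}` are known to be linearly
independent in `Q(p)` (`linearIndependent_chainAdm`), since the map from the presented algebra to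
`Q(p)` carries the spanning family to an independent one.

For the independence, `Q(p)` is represented with `z_{1,h}` acting by zero. The reduced powers act
from the right on `𝔽_p[ξ_1, ξ_2, …]` by the coefficients of
`Ψ_t : ξ_k ↦ ξ_k + t ^ (p ^ (k-1)) * ξ_{k-1}`. The composite `Ψ_b ∘ Ψ_a` depends only on `a + b` and
`a ^ p * b`, which gives the Bullett–Macdonald identity (`bullettMacdonald`), and a residue
computation extracts the Adem relations from it (`dNat_comp`, `dInt_adem`). In this action
operations of negative index vanish; this is cured by the symmetry of the relations that shifts the
`i`-th letter of a word of length `m` by `p ^ (m - i) * c`, which the representation `rep` builds in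
together with the grading by length. The monomial `∏ ξ_i ^ (h_i - p * h_{i+1})` is sent to `1` by the
admissible word `(h_1, …, h_m)` and to `0` by every lexicographically larger word of length `m`,
because the degree in `t` of its image under `Ψ_t` is `h_1`
(`coaction_testVector_top`).
-/

namespace UnivSteenrod

/-! ### Families satisfying the Adem relations -/

/-- The coefficient `(-1)^j * binom ((p - 1) * (n - j) - 1) j` of the Adem relation `R(0, k, n)`. -/
def ademCoeff (p n j : ℕ) : ZMod p :=
  (-1 : ZMod p) ^ j * (binom (((p : ℤ) - 1) * ((n : ℤ) - j) - 1) j : ZMod p)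

/-- The family `w` of elements of an algebra satisfies the relations `R(0, k, n) = 0` with `w k` in
place of `z_{0,k}`. -/
def SatisfiesAdem (p : ℕ) {B : Type*} [Ring B] [Algebra (ZMod p) B] (w : ℤ → B) : Prop :=
  ∀ (k : ℤ) (n : ℕ), w (p * k - 1 - n) * w k
    + ∑ j ∈ Finset.range (n + 1), ademCoeff p n j • (w (p * k - 1 - j) * w (k - n + j)) = 0

/-- Admissibility of a label all of whose `ε`'s are zero. -/
def ChainAdm (p : ℕ) (l : List ℤ) : Prop := l.IsChain fun a b : ℤ => a ≥ p * b

theorem binom_of_neg {a : ℤ} (h : a < 0) (j : ℕ) : binom a j = 0 := by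
  simp [binom, not_le.2 h]

theorem binom_natCast (a j : ℕ) : binom (a : ℤ) j = a.choose j := by simp [binom]

theorem ademCoeff_eq_zero {p n j : ℕ} (hp : 0 < p) (h : n ≤ j) : ademCoeff p n j = 0 := by
  have : ((p : ℤ) - 1) * ((n : ℤ) - j) - 1 < 0 := by
    have h1 : (0 : ℤ) ≤ (p : ℤ) - 1 := by omega
    have h2 : (n : ℤ) - j ≤ 0 := by omega
    nlinarith [mul_nonneg h1 (neg_nonneg.2 h2)]
  simp [ademCoeff, binom_of_neg this]

/-! ### Adem coefficients modulo `p` -/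

section Lucas

variable {p : ℕ} [Fact p.Prime]

/-- Lucas' congruence for one digit; it also holds for a negative upper index, where both sides
vanish. -/
theorem binom_lucas (A : ℤ) (a r j : ℕ) (ha : a < p) (hr : r < p) :
    (binom (p * A + a) (p * j + r) : ZMod p) = binom A j * (a.choose r : ZMod p) := by
  have hp : 0 < p := (Fact.out : p.Prime).pos
  rcases lt_or_ge A 0 with hA | hA
  · have : (p : ℤ) * A + a < 0 := by
      have : (p : ℤ) * A ≤ p * (-1) := by gcongr; omega
      omega
    simp [binom_of_neg this, binom_of_neg hA]
  · obtain ⟨A, rfl⟩ := Int.eq_ofNat_of_zero_le hA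
    have := Choose.choose_modEq_choose_mod_mul_choose_div_nat (n := p * A + a) (k := p * j + r)
      (p := p)
    rw [show (p : ℤ) * (A : ℕ) + a = ((p * A + a : ℕ) : ℤ) by push_cast; ring, binom_natCast,
      binom_natCast, (ZMod.natCast_eq_natCast_iff _ _ _).2 this]
    simp [Nat.mul_add_div hp, Nat.mod_eq_of_lt ha, Nat.mod_eq_of_lt hr,
      Nat.div_eq_of_lt ha, Nat.div_eq_of_lt hr, mul_comm]

theorem ademCoeff_mul_of_not_dvd {n j : ℕ} (h : ¬ p ∣ j) : ademCoeff p (p * n) j = 0 := by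
  have hp : 0 < p := (Fact.out : p.Prime).pos
  have hr : 0 < j % p := Nat.pos_of_ne_zero fun h0 => h (Nat.dvd_of_mod_eq_zero h0)
  have hr' := Nat.mod_lt j hp
  have hj : j = p * (j / p) + j % p := (Nat.div_add_mod j p).symm
  set q := j / p
  set r := j % p
  have e : ((p : ℤ) - 1) * (((p * n : ℕ) : ℤ) - (j : ℕ)) - 1
      = p * (((p : ℤ) - 1) * (n - q) - r) + ((r - 1 : ℕ) : ℤ) := by
    rw [hj]; push_cast [Nat.cast_sub (show 1 ≤ r from hr)]; ring
  rw [ademCoeff, e, hj, binom_lucas _ _ _ _ (by omega) hr',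
    Nat.choose_eq_zero_of_lt (show r - 1 < r by omega)]
  simp

theorem ademCoeff_mul_mul (hp2 : p ≠ 2) (n j : ℕ) :
    ademCoeff p (p * n) (p * j) = ademCoeff p n j := by
  have hp : 0 < p := (Fact.out : p.Prime).pos
  have e : ((p : ℤ) - 1) * (((p * n : ℕ) : ℤ) - (p * j : ℕ)) - 1
      = p * (((p : ℤ) - 1) * (n - j) - 1) + ((p - 1 : ℕ) : ℤ) := by
    push_cast [Nat.cast_sub (show 1 ≤ p from hp)]; ring
  have hodd : Odd p := (Fact.out : p.Prime).odd_of_ne_two hp2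
  have := binom_lucas (p := p) (((p : ℤ) - 1) * (n - j) - 1) (p - 1) 0 j (by omega) hp
  rw [add_zero] at this
  rw [ademCoeff, e, this, pow_mul, hodd.neg_one_pow]
  simp [ademCoeff]

/-- The relation `R(0, k, p^s n)` involves only the `j` divisible by `p^s`, with the coefficients of
`R(0, k', n)`: in base `p`, the upper index `(p - 1) * (p * n - j) - 1` ends in one less than `j` if
`p ∤ j`, and in `p - 1` otherwise. -/
theorem sum_ademCoeff_pow (hp2 : p ≠ 2) {M : Type*} [AddCommGroup M] [Module (ZMod p) M]
    (s n : ℕ) (F : ℕ → M) :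
    ∑ j ∈ Finset.range (p ^ s * n + 1), ademCoeff p (p ^ s * n) j • F j
      = ∑ j ∈ Finset.range (n + 1), ademCoeff p n j • F (p ^ s * j) := by
  have hp : 0 < p := (Fact.out : p.Prime).pos
  induction s generalizing F with
  | zero => simp
  | succ s ih =>
    have key : ∀ (N : ℕ), ∑ j ∈ Finset.range (p * N + 1), ademCoeff p (p * N) j • F j
        = ∑ j ∈ Finset.range (N + 1), ademCoeff p N j • F (p * j) := by
      intro N
      symm
      refine Finset.sum_of_injOn (p * ·) ?_ ?_ ?_ ?_
      · intro a _ b _ h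
        exact Nat.eq_of_mul_eq_mul_left hp h
      · intro a ha
        simp only [Finset.coe_range, Set.mem_Iio] at ha ⊢
        have : p * a ≤ p * N := Nat.mul_le_mul_left _ (by omega)
        omega
      · intro j hj hj'
        rw [ademCoeff_mul_of_not_dvd, zero_smul]
        rintro ⟨q, rfl⟩
        refine hj' ⟨q, ?_, rfl⟩
        simp only [Finset.mem_range, Finset.coe_range, Set.mem_Iio] at hj ⊢
        have : p * q ≤ p * N := by omega
        have := Nat.le_of_mul_le_mul_left this hp
        omega
      · intro j _
        rw [ademCoeff_mul_mul hp2]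
    rw [pow_succ', mul_assoc, key, ih (fun j => F (p * j))]
    simp only [mul_assoc]

end Lucas

/-! ### Admissible monomials span -/

section Span

variable (p : ℕ)

/-- The moment `∑ (m + 1 - i) * h_i` of `(h_1, …, h_m)`. Moving weight to the left inside a pair of
neighbours increases it. -/
def moment : List ℤ → ℤ
  | [] => 0
  | h :: t => (t.length + 1) * h + moment t

/-- The bound `h_i ≤ p ^ (m - i) * C` on the entries of `(h_1, …, h_m)`. Its shape makes it stable
under the Adem relations, whose new left entry is less than `p` times the old right entry. -/
def BoundedBy (C : ℕ) : List ℤ → Prop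
  | [] => True
  | h :: t => h ≤ (p : ℤ) ^ t.length * C ∧ BoundedBy C t

theorem exists_moment_le (C m : ℕ) :
    ∃ M : ℤ, ∀ l : List ℤ, l.length = m → BoundedBy p C l → moment l ≤ M := by
  induction m with
  | zero =>
    refine ⟨0, fun l hl _ => ?_⟩
    rw [List.length_eq_zero_iff] at hl
    simp [hl, moment]
  | succ m ih =>
    obtain ⟨M, hM⟩ := ih
    refine ⟨(m + 1) * ((p : ℤ) ^ m * C) + M, fun l hl hb => ?_⟩
    obtain _ | ⟨h, t⟩ := l
    · simp at hl
    · obtain ⟨hb1, hb2⟩ := hb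
      have ht : t.length = m := by simpa using hl
      rw [ht] at hb1
      have := hM t ht hb2
      simp only [moment, ht]
      gcongr

theorem exists_boundedBy (hp : 0 < p) (l : List ℤ) : ∃ C, BoundedBy p C l := by
  have mono : ∀ (t : List ℤ) (C D : ℕ), C ≤ D → BoundedBy p C t → BoundedBy p D t := by
    intro t C D hCD
    induction t with
    | nil => exact id
    | cons h t ih =>
      rintro ⟨h1, h2⟩
      refine ⟨h1.trans ?_, ih h2⟩
      gcongr
  induction l with
  | nil => exact ⟨0, trivial⟩
  | cons h t ih =>
    obtain ⟨C, hC⟩ := ih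
    refine ⟨C + h.toNat, ?_, mono _ _ _ (by omega) hC⟩
    have h1 : (1 : ℤ) ≤ (p : ℤ) ^ t.length := one_le_pow₀ (by omega)
    have h2 : h ≤ ((C + h.toNat : ℕ) : ℤ) := by omega
    nlinarith [Int.natCast_nonneg (C + h.toNat)]

theorem BoundedBy.replace {p C : ℕ} {a b a' b' : ℤ} {l₂ : List ℤ} (ha : a' ≤ p * b) (hb : b' ≤ b)
    (l₁ : List ℤ) (h : BoundedBy p C (l₁ ++ a :: b :: l₂)) :
    BoundedBy p C (l₁ ++ a' :: b' :: l₂) := by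
  induction l₁ with
  | nil =>
    obtain ⟨_, h2, h3⟩ := h
    refine ⟨ha.trans ?_, hb.trans h2, h3⟩
    rw [List.length_cons, pow_succ', mul_assoc]
    gcongr
  | cons x l₁ ih =>
    refine ⟨?_, ih h.2⟩
    have := h.1
    simpa using this

theorem moment_replace {a b a' b' : ℤ} {l₂ : List ℤ} (hs : a + b = a' + b') (l₁ : List ℤ) :
    moment (l₁ ++ a' :: b' :: l₂) = moment (l₁ ++ a :: b :: l₂) + (a' - a) := by
  induction l₁ with
  | nil =>
    obtain rfl : b' = a + b - a' := by omega
    simp only [List.nil_append, moment, List.length_cons]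
    push_cast
    ring
  | cons x l₁ ih =>
    simp only [List.cons_append, moment, ih, List.length_append, List.length_cons]
    ring

variable {p} {B : Type*} [Ring B] [Algebra (ZMod p) B] {w : ℤ → B}

/-- The Adem relations rewrite any monomial into admissible ones. Each rewriting keeps the length and
the bound `BoundedBy p C`, hence bounds the moment above, while it increases the moment. -/
theorem SatisfiesAdem.prod_mem_span (hw : SatisfiesAdem p w) (hp : 0 < p) (l : List ℤ) :
    (l.map w).prod ∈ Submodule.span (ZMod p)
      (Set.range fun l : {l : List ℤ // ChainAdm p l} => (l.1.map w).prod) := by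
  obtain ⟨C, hC⟩ := exists_boundedBy p hp l
  obtain ⟨M, hM⟩ := exists_moment_le p C l.length
  obtain ⟨m, hm⟩ : ∃ m : ℕ, (M - moment l).toNat = m := ⟨_, rfl⟩
  obtain ⟨L, hL⟩ : ∃ L : ℕ, l.length = L := ⟨_, rfl⟩
  rw [hL] at hM
  induction m using Nat.strong_induction_on generalizing l with
  | _ m ih =>
    by_cases hl : ChainAdm p l
    · exact Submodule.subset_span ⟨⟨l, hl⟩, rfl⟩
    rw [ChainAdm, List.isChain_iff_forall_rel_of_append_cons_cons] at hl
    push Not at hl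
    obtain ⟨a, b, l₁, l₂, rfl, hab⟩ := hl
    obtain ⟨n, hn⟩ : ∃ n : ℕ, (n : ℤ) = p * b - 1 - a := ⟨(p * b - 1 - a).toNat, by omega⟩
    obtain rfl : a = p * b - 1 - n := by omega
    have key := hw b n
    have e : ((l₁ ++ (p * b - 1 - n : ℤ) :: b :: l₂).map w).prod
        = -∑ j ∈ Finset.range (n + 1), ademCoeff p n j •
          ((l₁ ++ (p * b - 1 - j : ℤ) :: (b - n + j) :: l₂).map w).prod := by
      simp only [List.map_append, List.map_cons, List.prod_append, List.prod_cons]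
      have : w (p * b - 1 - n) * (w b * (l₂.map w).prod) =
          (w (p * b - 1 - n) * w b) * (l₂.map w).prod := by rw [mul_assoc]
      rw [this, eq_neg_of_add_eq_zero_left key, neg_mul, mul_neg, Finset.sum_mul, Finset.mul_sum]
      congr 1
      refine Finset.sum_congr rfl fun j _ => ?_
      rw [smul_mul_assoc, mul_smul_comm, mul_assoc]
    rw [e]
    refine Submodule.neg_mem _ (Submodule.sum_mem _ fun j _ => ?_)
    rcases le_or_gt n j with hj | hj
    · rw [ademCoeff_eq_zero hp hj, zero_smul]
      exact Submodule.zero_mem _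
    refine Submodule.smul_mem _ _ ?_
    have hlen : (l₁ ++ (p * b - 1 - j : ℤ) :: (b - n + j) :: l₂).length = L := by
      rw [← hL]; simp
    have hb' := hC.replace (a' := p * b - 1 - j) (b' := b - n + j) (by omega) (by omega)
    have hle := hM _ hlen hb'
    have hmom := moment_replace (a := p * b - 1 - n) (b := b) (a' := p * b - 1 - j)
      (b' := b - n + j) (l₂ := l₂) (by ring) l₁
    exact ih _ (by omega) _ hb' rfl hlen

theorem SatisfiesAdem.adjoin_eq_span (hw : SatisfiesAdem p w) (hp : 0 < p) :
    Subalgebra.toSubmodule (Algebra.adjoin (ZMod p) (Set.range w)) = Submodule.span (ZMod p)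
      (Set.range fun l : {l : List ℤ // ChainAdm p l} => (l.1.map w).prod) := by
  refine le_antisymm ?_ (Submodule.span_le.2 ?_)
  · rw [Algebra.adjoin_eq_span, Submodule.span_le]
    intro x hx
    obtain ⟨l, hl, rfl⟩ := Submonoid.exists_list_of_mem_closure hx
    choose! f hf using hl
    have : l = (l.map f).map w := by
      rw [List.map_map]
      exact (List.map_id l).symm.trans (List.map_congr_left fun x hx => (hf x hx).symm)
    rw [this]
    exact hw.prod_mem_span hp _
  · rintro _ ⟨l, rfl⟩
    refine Subalgebra.list_prod_mem _ fun x hx => ?_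
    obtain ⟨h, _, rfl⟩ := List.mem_map.1 hx
    exact Algebra.subset_adjoin ⟨h, rfl⟩

end Span

/-! ### The total operation on the dual algebra of reduced powers -/

section Coaction

variable (p : ℕ)

/-- The polynomial algebra `𝔽_p[ξ_1, ξ_2, …]` underlying the dual of the algebra of reduced powers;
the variable `X k` is `ξ_{k+1}`, and `ξ_0 = 1`. -/
abbrev Milnor : Type := MvPolynomial ℕ (ZMod p)

/-- The total operation `Ψ_t` on `𝔽_p[ξ_1, ξ_2, …]`: the algebra map
`ξ_{k+1} ↦ ξ_{k+1} + t ^ (p ^ k) * ξ_k`, with `ξ_0 = 1`. Its coefficients are a right action of the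
reduced powers. -/
noncomputable def coaction : Milnor p →ₐ[ZMod p] Polynomial (Milnor p) :=
  MvPolynomial.aeval fun k : ℕ =>
    Polynomial.C (MvPolynomial.X k) + Polynomial.X ^ p ^ k *
      Nat.casesOn k 1 fun i => Polynomial.C (MvPolynomial.X i)

theorem coaction_zero : coaction p (MvPolynomial.X 0)
    = Polynomial.C (MvPolynomial.X 0) + Polynomial.X := by
  simp [coaction]

theorem coaction_succ (k : ℕ) : coaction p (MvPolynomial.X (k + 1))
    = Polynomial.C (MvPolynomial.X (k + 1))
      + Polynomial.X ^ p ^ (k + 1) * Polynomial.C (MvPolynomial.X k) := by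
  simp [coaction]

/-- The coefficient of `t ^ i` in the total operation: the right action of `P^i`. -/
noncomputable def dNat (i : ℕ) : Milnor p →ₗ[ZMod p] Milnor p :=
  ((Polynomial.lcoeff (Milnor p) i).restrictScalars (ZMod p)).comp (coaction p).toLinearMap

theorem dNat_apply (i : ℕ) (v : Milnor p) : dNat p i v = (coaction p v).coeff i := rfl

/-- The right action of `P^i` for `i ∈ ℤ`, where `P^i = 0` for `i < 0`. -/
noncomputable def dInt (i : ℤ) : Milnor p →ₗ[ZMod p] Milnor p :=
  if 0 ≤ i then dNat p i.toNat else 0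

theorem dInt_natCast (i : ℕ) : dInt p i = dNat p i := by simp [dInt]

theorem dInt_of_neg {i : ℤ} (h : i < 0) : dInt p i = 0 := by simp [dInt, not_le.2 h]

variable {S : Type*} [CommRing S] [Algebra (Milnor p) S]

/-- The total operation with `t` specialised to an element `b` of an algebra. -/
noncomputable def coactionEval (b : S) : Milnor p →+* S :=
  (Polynomial.eval₂RingHom (algebraMap (Milnor p) S) b).comp (coaction p).toRingHom

/-- The composite `Ψ_b ∘ Ψ_a` of two specialised total operations; `a` and `b` are constants for
them, so `Ψ_b` is applied to the coefficients of `Ψ_a v`. -/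
noncomputable def coactionEval₂ (a b : S) : Milnor p →+* S :=
  (Polynomial.eval₂RingHom (coactionEval p b) a).comp (coaction p).toRingHom

theorem coactionEval_apply (b : S) (v : Milnor p) :
    coactionEval p b v = (coaction p v).eval₂ (algebraMap (Milnor p) S) b := rfl

theorem coactionEval₂_apply (a b : S) (v : Milnor p) :
    coactionEval₂ p a b v = (coaction p v).eval₂ (coactionEval p b) a := rfl

/-- The composite `Ψ_b ∘ Ψ_a` maps `ξ_k` to
`ξ_k + (a + b) ^ (p ^ (k-1)) * ξ_{k-1} + (a ^ p * b) ^ (p ^ (k-2)) * ξ_{k-2}`, so it depends only on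
`a + b` and `a ^ p * b`. -/
theorem coactionEval₂_eq [Fact p.Prime] [CharP S p] {a b a' b' : S} (h₁ : a + b = a' + b')
    (h₂ : a ^ p * b = a' ^ p * b') : coactionEval₂ p a b = coactionEval₂ p a' b' := by
  have hx : ∀ (b : S) (k : ℕ), coactionEval p b (MvPolynomial.X (k + 1))
      = algebraMap (Milnor p) S (MvPolynomial.X (k + 1))
        + b ^ p ^ (k + 1) * algebraMap (Milnor p) S (MvPolynomial.X k) := by
    intro b k
    simp [coactionEval_apply, coaction_succ, -Polynomial.X_pow_mul_C]
  have hp₁ : ∀ k, a ^ p ^ k + b ^ p ^ k = a' ^ p ^ k + b' ^ p ^ k := by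
    intro k
    rw [← add_pow_char_pow, ← add_pow_char_pow, h₁]
  have hp₂ : ∀ k, a ^ p ^ (k + 1) * b ^ p ^ k = a' ^ p ^ (k + 1) * b' ^ p ^ k := by
    intro k
    rw [pow_succ', pow_mul, pow_mul, ← mul_pow, ← mul_pow, h₂]
  refine MvPolynomial.ringHom_ext (fun r => ?_) fun k => ?_
  · simp [coactionEval₂_apply, coactionEval_apply]
  · obtain _ | _ | k := k
    · simp only [coactionEval₂_apply, coactionEval_apply, coaction_zero, Polynomial.eval₂_add,
        Polynomial.eval₂_C, Polynomial.eval₂_X]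
      linear_combination h₁
    · have := hp₂ 0
      simp only [zero_add, pow_one, pow_zero] at this
      have h' := hp₁ 1
      simp only [coactionEval₂_apply, coaction_succ, Polynomial.eval₂_add, Polynomial.eval₂_mul,
        Polynomial.eval₂_pow, Polynomial.eval₂_C, Polynomial.eval₂_X, hx]
      simp only [coactionEval_apply, coaction_zero, Polynomial.eval₂_add,
        Polynomial.eval₂_C, Polynomial.eval₂_X]
      simp only [zero_add, pow_one] at h' ⊢
      linear_combination this + algebraMap (Milnor p) S (MvPolynomial.X 0) * h'
    · simp only [coactionEval₂_apply, coaction_succ, Polynomial.eval₂_add, Polynomial.eval₂_mul,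
        Polynomial.eval₂_pow, Polynomial.eval₂_C, Polynomial.eval₂_X, hx]
      linear_combination algebraMap (Milnor p) S (MvPolynomial.X k) * hp₂ (k + 1)
        + algebraMap (Milnor p) S (MvPolynomial.X (k + 1)) * hp₁ (k + 2)

theorem exists_coactionEval₂_eq_sum (v : Milnor p) : ∃ K₀ : ℕ, ∀ K, K₀ ≤ K → ∀ a b : S,
    coactionEval₂ p a b v = ∑ i ∈ Finset.range K, ∑ j ∈ Finset.range K,
      a ^ i * b ^ j * algebraMap (Milnor p) S (dNat p j (dNat p i v)) := by
  refine ⟨(coaction p v).natDegree + 1 + ((Finset.range ((coaction p v).natDegree + 1)).sup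
    fun i => (coaction p (dNat p i v)).natDegree + 1), fun K hK a b => ?_⟩
  have hlt : (coaction p v).natDegree < K := by omega
  rw [coactionEval₂_apply, Polynomial.eval₂_eq_sum_range' _ hlt]
  refine Finset.sum_congr rfl fun i _ => ?_
  have hi : (coaction p (dNat p i v)).natDegree < K := by
    rcases le_or_gt i (coaction p v).natDegree with h | h
    · have := Finset.le_sup (f := fun i => (coaction p (dNat p i v)).natDegree + 1)
        (show i ∈ Finset.range ((coaction p v).natDegree + 1) from
          Finset.mem_range.2 (by omega))
      omega
    · rw [dNat_apply, Polynomial.coeff_eq_zero_of_natDegree_lt h]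
      simp; omega
  rw [← dNat_apply, coactionEval_apply, Polynomial.eval₂_eq_sum_range' _ hi, Finset.sum_mul]
  refine Finset.sum_congr rfl fun j _ => ?_
  rw [← dNat_apply]
  ring

end Coaction

/-! ### The Adem relations by residues -/

section PowerSeries

open PowerSeries

theorem coeff_one_sub_X_pow {R : Type*} [CommRing R] (n m : ℕ) :
    coeff m ((1 - X : R⟦X⟧) ^ n) = (-1) ^ m * (n.choose m : R) := by
  have : (1 - X : R⟦X⟧) ^ n = rescale (-1) (((1 + Polynomial.X : Polynomial R) ^ n : _) : R⟦X⟧) := by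
    simp [sub_eq_add_neg]
  rw [this, coeff_rescale, Polynomial.coeff_coe, Polynomial.coeff_one_add_X_pow]

variable {p : ℕ} [Fact p.Prime]

theorem choose_mul_self_eq_zero {R : Type*} [CommRing R] [CharP R p] {m : ℕ} (hm : 0 < m) :
    ((p * m).choose m : R) = 0 := by
  have hp : 0 < p := (Fact.out : p.Prime).pos
  rw [CharP.cast_eq_zero_iff R p, ← Nat.modEq_zero_iff_dvd]
  induction m using Nat.strong_induction_on with
  | _ m ih =>
    refine (Choose.choose_modEq_choose_mod_mul_choose_div_nat (p := p)).trans ?_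
    rw [Nat.mul_mod_right, Nat.mul_div_cancel_left _ hp]
    rcases Nat.eq_zero_or_pos (m % p) with h | h
    · obtain ⟨q, rfl⟩ := Nat.dvd_of_mod_eq_zero h
      have hq : 0 < q := Nat.pos_of_mul_pos_left hm
      rw [Nat.mul_div_cancel_left _ hp, h]
      simpa using ih q (by nlinarith [(Fact.out : p.Prime).two_le]) hq
    · rw [Nat.choose_eq_zero_of_lt h]
      simp [Nat.ModEq]

instance charP_powerSeries {R : Type*} [CommRing R] [CharP R p] : CharP R⟦X⟧ p :=
  charP_of_injective_ringHom (PowerSeries.C_injective (R := R)) p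

/-- The Bullett–Macdonald identity `Ψ_1 ∘ Ψ_{tu} = Ψ_{t^p} ∘ Ψ_u` with `u = (1 - t) ^ (p - 1)`, in total
degree `N`. -/
theorem bullettMacdonald (N : ℕ) (v : Milnor p) :
    ∑ i ∈ Finset.range (N + 1), (X * (1 - X) ^ (p - 1)) ^ i
        * C (dNat p (N - i) (dNat p i v))
      = ∑ i ∈ Finset.range (N + 1), ((1 - X) ^ (p - 1)) ^ i * (X ^ p) ^ (N - i)
        * C (dNat p (N - i) (dNat p i v)) := by
  have hp : 0 < p := (Fact.out : p.Prime).pos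
  set u : (Milnor p)⟦X⟧ := (1 - X) ^ (p - 1) with hu
  have hu1 : X * u + 1 = u + X ^ p := by
    have : (1 - X) * u = 1 - X ^ p := by
      rw [hu, ← pow_succ', Nat.sub_add_cancel hp, sub_pow_char, one_pow]
    linear_combination -this
  -- scaling both parameters by a new variable `L` separates the total degrees
  let L : Polynomial (Milnor p)⟦X⟧ := Polynomial.X
  obtain ⟨K₀, hK₀⟩ := exists_coactionEval₂_eq_sum p (S := Polynomial (Milnor p)⟦X⟧) v
  have hK := hK₀ (K₀ + N + 1) (by omega)
  have h := congrArg (fun f => (f v).coeff N) (coactionEval₂_eq p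
    (a := Polynomial.C (X * u) * L) (b := Polynomial.C 1 * L) (a' := Polynomial.C u * L)
    (b' := Polynomial.C (X ^ p) * L) (by rw [← add_mul, ← add_mul, ← map_add, ← map_add, hu1])
    (by
      rw [mul_pow, mul_pow]
      simp only [map_mul, map_pow, map_one]
      ring))
  have key : ∀ x y : (Milnor p)⟦X⟧,
      (coactionEval₂ p (Polynomial.C x * L) (Polynomial.C y * L) v).coeff N
        = ∑ i ∈ Finset.range (N + 1), x ^ i * y ^ (N - i) * C (dNat p (N - i) (dNat p i v)) := by
    intro x y
    rw [hK, Polynomial.finsetSum_coeff]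
    have term : ∀ i j, ((Polynomial.C x * L) ^ i * (Polynomial.C y * L) ^ j
        * algebraMap (Milnor p) (Polynomial (Milnor p)⟦X⟧) (dNat p j (dNat p i v))).coeff N
        = if j + i = N then x ^ i * y ^ j * C (dNat p j (dNat p i v)) else 0 := by
      intro i j
      have : (Polynomial.C x * L) ^ i * (Polynomial.C y * L) ^ j
          * algebraMap (Milnor p) (Polynomial (Milnor p)⟦X⟧) (dNat p j (dNat p i v))
          = Polynomial.C (x ^ i * y ^ j * C (dNat p j (dNat p i v))) * Polynomial.X ^ (j + i) := by
        rw [show algebraMap (Milnor p) (Polynomial (Milnor p)⟦X⟧) (dNat p j (dNat p i v))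
          = Polynomial.C (C (dNat p j (dNat p i v))) from rfl]
        simp only [mul_pow, map_mul, map_pow, L]
        ring
      rw [this, Polynomial.coeff_C_mul_X_pow]
      simp only [eq_comm]
    simp only [Polynomial.finsetSum_coeff, term]
    rw [show K₀ + N + 1 = (N + 1) + K₀ by ring, Finset.sum_range_add]
    rw [Finset.sum_eq_zero (s := Finset.range K₀), add_zero]
    · refine Finset.sum_congr rfl fun i hi => ?_
      rw [Finset.mem_range] at hi
      rw [Finset.sum_eq_single (N - i), if_pos (by omega)]
      · intro j _ hj
        rw [if_neg (by omega)]
      · intro hj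
        exact absurd (Finset.mem_range.2 (by omega)) hj
    · intro i _
      refine Finset.sum_eq_zero fun j _ => if_neg (by omega)
  rw [key, key] at h
  simpa only [one_pow, mul_one] using h

/-- The residue that extracts the coefficient of `s ^ a` from a polynomial in `s = t (1 - t) ^ (p - 1)`:
in characteristic `p` one has `ds = (1 - t) ^ (p - 2) dt`, so that `s ^ (-a - 1) ds` is
`t ^ (-a - 1) (1 - t) ^ (-(p - 1) a - 1) dt`. -/
theorem residue_left (a i : ℕ) {R : Type*} [CommRing R] [CharP R p] :
    coeff a ((X * (1 - X : R⟦X⟧) ^ (p - 1)) ^ i * (invOneSubPow R ((p - 1) * a + 1)).val)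
      = if i = a then 1 else 0 := by
  have hp : 0 < p := (Fact.out : p.Prime).pos
  rw [mul_pow, mul_assoc, coeff_X_pow_mul', ← pow_mul]
  split_ifs with h1 h2 h2
  · subst h2
    rw [Nat.sub_self, add_comm, one_sub_pow_mul_invOneSubPow_val_add_eq_invOneSubPow_val]
    simp [invOneSubPow_val_eq_mk_sub_one_add_choose_of_pos]
  · obtain ⟨m, rfl⟩ := Nat.exists_eq_add_of_le h1
    rw [show (p - 1) * (i + m) + 1 = ((p - 1) * m + 1) + (p - 1) * i by ring,
      one_sub_pow_mul_invOneSubPow_val_add_eq_invOneSubPow_val,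
      invOneSubPow_val_succ_eq_mk_add_choose, coeff_mk, Nat.add_sub_cancel_left]
    rw [show (p - 1) * m + m = p * m by
      rw [← Nat.succ_mul, Nat.succ_eq_add_one, Nat.sub_add_cancel hp],
      show (p - 1) * m = p * m - m by rw [Nat.sub_mul, one_mul],
      Nat.choose_symm (Nat.le_mul_of_pos_left m hp)]
    exact choose_mul_self_eq_zero (by omega)
  · omega
  · rfl

/-- The same residue applied to the terms `u ^ (a + b - d) * t ^ (p * d)`; it gives the coefficients
of the Adem relations. -/
theorem residue_right (a b d : ℕ) (hd : d ≤ a + b) (hab : a < p * b) {R : Type*} [CommRing R] :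
    coeff a (((1 - X : R⟦X⟧) ^ (p - 1)) ^ (a + b - d) * (X ^ p) ^ d
        * (invOneSubPow R ((p - 1) * a + 1)).val)
      = if p * d ≤ a then
          (-1) ^ (a - p * d) * (((p - 1) * (b - d) - 1).choose (a - p * d) : R) else 0 := by
  have hp : 1 < p := (Fact.out : p.Prime).one_lt
  rw [mul_comm (((1 - X : R⟦X⟧) ^ (p - 1)) ^ (a + b - d)), mul_assoc, ← pow_mul, ← pow_mul,
    coeff_X_pow_mul']
  split_ifs with h
  · have hdb : d < b := lt_of_mul_lt_mul_left (h.trans_lt hab) (Nat.zero_le p)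
    obtain ⟨q, rfl⟩ := Nat.exists_eq_add_of_lt hdb
    have e : (p - 1) * (a + (d + q + 1) - d)
        = ((p - 1) * (d + q + 1 - d) - 1) + ((p - 1) * a + 1) := by
      rw [show a + (d + q + 1) - d = a + (q + 1) by omega,
        show d + q + 1 - d = q + 1 by omega, mul_add]
      have : 0 < (p - 1) * (q + 1) := by apply Nat.mul_pos <;> omega
      omega
    rw [e, one_sub_pow_add_mul_invOneSubPow_val_eq_one_sub_pow, coeff_one_sub_X_pow]
  · rfl

/-- The classical Adem relations for the right action on `𝔽_p[ξ_1, ξ_2, …]`. -/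
theorem dNat_comp (a b : ℕ) (hab : a < p * b) (v : Milnor p) :
    dNat p b (dNat p a v) = ∑ d ∈ Finset.range (a + b + 1), (if p * d ≤ a then
      (-1) ^ (a - p * d) * (((p - 1) * (b - d) - 1).choose (a - p * d) : Milnor p) else 0)
        * dNat p d (dNat p (a + b - d) v) := by
  have h := congrArg (fun f => coeff a (f * (invOneSubPow (Milnor p) ((p - 1) * a + 1)).val))
    (bullettMacdonald (a + b) v)
  simp only [Finset.sum_mul, map_sum] at h
  rw [← Finset.sum_range_reflect (fun i => coeff a (((1 - X) ^ (p - 1)) ^ i *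
    (X ^ p) ^ (a + b - i) * C (dNat p (a + b - i) (dNat p i v)) *
    (invOneSubPow (Milnor p) ((p - 1) * a + 1)).val))] at h
  rw [Finset.sum_eq_single a] at h
  · rw [mul_right_comm, coeff_mul_C, residue_left, if_pos rfl, one_mul,
      Nat.add_sub_cancel_left] at h
    rw [h]
    refine Finset.sum_congr rfl fun d hd => ?_
    rw [Finset.mem_range] at hd
    rw [← residue_right a b d (by omega) hab, ← coeff_mul_C,
      show a + b + 1 - 1 - d = a + b - d by omega, show a + b - (a + b - d) = d by omega,
      mul_right_comm]
  · intro i _ hi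
    rw [mul_right_comm, coeff_mul_C, residue_left, if_neg hi, zero_mul]
  · intro ha
    exact absurd (Finset.mem_range.2 (by omega)) ha

end PowerSeries
/-! ### The generalized Adem relations for the action -/

section Adem

variable {p : ℕ} [Fact p.Prime]

/-- The coefficients of the classical Adem relation for `P^a P^b` with `a = p * b - 1 - n`, numbered by
`d`, are those of `R(0, b, n)` with `d = b - n + j`, up to sign. -/
theorem ademCoeff_eq_neg_residue {R : Type*} [CommRing R] [Algebra (ZMod p) R] (hp2 : p ≠ 2)
    {a b d n j : ℕ} (hj : j < n) (ha : a + 1 + n = p * b) (hd : d + n = b + j) :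
    algebraMap (ZMod p) R (ademCoeff p n j) = -(if p * d ≤ a then
      (-1) ^ (a - p * d) * (((p - 1) * (b - d) - 1).choose (a - p * d) : R) else 0) := by
  have hp : 1 < p := (Fact.out : p.Prime).one_lt
  have heven : Even (p - 1) := (Fact.out : p.Prime).even_sub_one hp2
  obtain ⟨q, rfl⟩ := Nat.exists_eq_add_of_lt hj
  obtain ⟨m, hm⟩ : ∃ m, (p - 1) * (q + 1) = m + 1 := by
    refine ⟨(p - 1) * (q + 1) - 1, (Nat.sub_add_cancel ?_).symm⟩
    apply Nat.mul_pos <;> omega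
  have hmodd : Odd m := by
    have := heven.mul_right (q + 1)
    rw [hm, Nat.even_add_one, Nat.not_even_iff_odd] at this
    exact this
  obtain rfl : b = d + (q + 1) := by omega
  have hm' : p * (q + 1) = m + 1 + (q + 1) := by
    rw [← hm, ← Nat.succ_mul, Nat.succ_eq_add_one, Nat.sub_add_cancel hp.le]
  rw [mul_add, hm'] at ha
  have hz : ((p : ℤ) - 1) * (((j + q + 1 : ℕ) : ℤ) - j) - 1 = (m : ℕ) := by
    have := congrArg (Nat.cast (R := ℤ)) hm
    push_cast [Nat.cast_sub hp.le] at this ⊢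
    linear_combination this
  rw [ademCoeff, hz, binom_natCast, Nat.add_sub_cancel_left, hm, Nat.add_sub_cancel]
  simp only [map_mul, map_pow, map_neg, map_one, map_natCast]
  split_ifs with h
  · have e : a - p * d = m - j := by omega
    rw [e, Nat.choose_symm (by omega)]
    have hs : (-1 : R) ^ (m - j) = -(-1) ^ j := by
      have h1 : (-1 : R) ^ (m - j) * (-1) ^ j = -1 := by
        rw [← pow_add, Nat.sub_add_cancel (by omega), hmodd.neg_one_pow]
      have h2 : (-1 : R) ^ j * (-1) ^ j = 1 := by rw [← mul_pow]; simp
      linear_combination (-1 : R) ^ j * h1 - (-1 : R) ^ (m - j) * h2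
    rw [hs]; ring
  · rw [Nat.choose_eq_zero_of_lt (show m < j by omega)]
    simp

theorem dInt_adem (hp2 : p ≠ 2) (k : ℤ) (n : ℕ) (v : Milnor p) :
    dInt p k (dInt p (p * k - 1 - n) v) + ∑ j ∈ Finset.range (n + 1),
      ademCoeff p n j • dInt p (k - n + j) (dInt p (p * k - 1 - j) v) = 0 := by
  have hp : 0 < p := (Fact.out : p.Prime).pos
  have hp1 : 1 < p := (Fact.out : p.Prime).one_lt
  -- if `k < 0`, then all the factors that act second have a negative index
  rcases lt_or_ge k 0 with hk | hk
  · rw [dInt_of_neg p hk, LinearMap.zero_apply, zero_add]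
    refine Finset.sum_eq_zero fun j hj => ?_
    rw [Finset.mem_range] at hj
    rw [dInt_of_neg p (show k - n + j < 0 by omega), LinearMap.zero_apply, smul_zero]
  obtain ⟨b, rfl⟩ := Int.eq_ofNat_of_zero_le hk
  rcases lt_or_ge ((p : ℤ) * b - 1 - n) 0 with ha | ha
  · rw [dInt_of_neg p ha, LinearMap.zero_apply, map_zero, zero_add]
    refine Finset.sum_eq_zero fun j hj => ?_
    rcases lt_or_ge ((b : ℤ) - n + j) 0 with h1 | h1
    · rw [dInt_of_neg p h1, LinearMap.zero_apply, smul_zero]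
    -- here the upper index `(p - 1) * (n - j) - 1` is smaller than `j`
    suffices h : ademCoeff p n j = 0 by rw [h, zero_smul]
    have hlt : ((p : ℤ) - 1) * ((n : ℤ) - j) - 1 < j := by
      have : (p : ℤ) * (n - j) ≤ p * b := by gcongr; omega
      linarith
    rw [ademCoeff]
    rcases lt_or_ge (((p : ℤ) - 1) * ((n : ℤ) - j) - 1) 0 with h2 | h2
    · simp [binom_of_neg h2]
    · obtain ⟨m, hm⟩ := Int.eq_ofNat_of_zero_le h2
      rw [hm] at hlt ⊢
      rw [binom_natCast, Nat.choose_eq_zero_of_lt (by omega)]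
      simp
  obtain ⟨a, ha'⟩ := Int.eq_ofNat_of_zero_le ha
  have hab : a + 1 + n = p * b := by zify; omega
  rw [ha', dInt_natCast, dInt_natCast, dNat_comp a b (by omega), add_eq_zero_iff_eq_neg,
    ← Finset.sum_neg_distrib]
  have value : ∀ j d : ℕ, j < n → d + n = b + j →
      (if p * d ≤ a then (-1) ^ (a - p * d) *
        (((p - 1) * (b - d) - 1).choose (a - p * d) : Milnor p) else 0)
        * dNat p d (dNat p (a + b - d) v)
      = -(ademCoeff p n j • dInt p (b - n + j) (dInt p (p * b - 1 - j) v)) := by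
    intro j d hj hd
    rw [show ((b : ℤ) - n + j) = (d : ℕ) by omega,
      show ((p : ℤ) * b - 1 - j) = ((a + b - d : ℕ) : ℤ) by omega, dInt_natCast, dInt_natCast,
      Algebra.smul_def, ademCoeff_eq_neg_residue hp2 hj hab hd]
    ring
  symm
  refine Finset.sum_bij_ne_zero (fun j _ _ => ((b : ℤ) - n + j).toNat) ?_ ?_ ?_ ?_
  all_goals
    have hj0 : ∀ j : ℕ, -(ademCoeff p n j •
        dInt p ((b : ℕ) - n + j : ℤ) (dInt p (p * (b : ℕ) - 1 - j : ℤ) v)) ≠ 0 →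
        j < n ∧ 0 ≤ (b : ℤ) - n + j := by
      intro j h
      constructor
      · by_contra hjn
        exact h (by rw [ademCoeff_eq_zero hp (by omega), zero_smul, neg_zero])
      · by_contra hneg
        exact h (by
          rw [dInt_of_neg p (by omega), LinearMap.zero_apply, smul_zero, neg_zero])
  · intro j _ h
    have := hj0 j h
    rw [Finset.mem_range]; omega
  · intro i _ hi j _ hj h
    have := hj0 i hi
    have := hj0 j hj
    omega
  · intro d _ hd
    have hda : p * d ≤ a := by
      by_contra h
      exact hd (by rw [if_neg h, zero_mul])
    have hdb : d < b := lt_of_mul_lt_mul_left (show p * d < p * b by omega) (Nat.zero_le p)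
    have hch : a - p * d ≤ (p - 1) * (b - d) - 1 := by
      by_contra h
      exact hd (by rw [Nat.choose_eq_zero_of_lt (by omega)]; simp)
    obtain ⟨q, rfl⟩ := Nat.exists_eq_add_of_lt hdb
    rw [show d + q + 1 - d = q + 1 by omega] at hch
    have hpos : 0 < (p - 1) * (q + 1) := by apply Nat.mul_pos <;> omega
    have hpq : p * (q + 1) = (p - 1) * (q + 1) + (q + 1) := by
      rw [← Nat.succ_mul, Nat.succ_eq_add_one, Nat.sub_add_cancel hp]
    have hexp : p * (d + q + 1) = p * d + p * (q + 1) := by ring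
    have hqn : q + 1 ≤ n := by omega
    refine ⟨d + n - (d + q + 1), Finset.mem_range.2 (by omega), ?_, by omega⟩
    rw [← value (d + n - (d + q + 1)) d (by omega) (by omega)]
    exact hd
  · intro j _ h
    have := hj0 j h
    exact (value j _ this.1 (by omega)).symm

end Adem

/-! ### A representation of the universal Steenrod algebra -/

section Representation

variable (p : ℕ) (c : ℕ)

/-- An operator on sequences in `𝔽_p[ξ_1, ξ_2, …]`: it sends the component `e + 1` to the component
`e` by `P^{h + p^e c}`. The component counts the letters still to come, so that the `i`-th letter of
a word of length `m` has its index shifted by `p ^ (m - i) * c`. -/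
noncomputable def shiftOp (h : ℤ) : Module.End (ZMod p) (ℕ → Milnor p) :=
  LinearMap.pi fun e => (dInt p (h + (p : ℤ) ^ e * c)).comp (LinearMap.proj (e + 1))

theorem shiftOp_apply (h : ℤ) (g : ℕ → Milnor p) (e : ℕ) :
    shiftOp p c h g e = dInt p (h + (p : ℤ) ^ e * c) (g (e + 1)) := rfl

/-- Shifting `k` by `p^e c` in `R(0, k, n)` shifts the left indices by `p^(e+1) c` and the right ones
by `p^e c`, so `shiftOp` inherits the Adem relations. -/
theorem shiftOp_adem [Fact p.Prime] (hp2 : p ≠ 2) :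
    SatisfiesAdem p fun h => MulOpposite.op (shiftOp p c h) := by
  intro k n
  apply MulOpposite.unop_injective
  refine LinearMap.ext fun g => funext fun e => ?_
  have := dInt_adem hp2 (k + (p : ℤ) ^ e * c) n (g (e + 2))
  simp only [MulOpposite.unop_add, MulOpposite.unop_mul, MulOpposite.unop_op, Finset.unop_sum,
    MulOpposite.unop_smul, LinearMap.add_apply, LinearMap.sum_apply, LinearMap.smul_apply,
    Pi.add_apply, Finset.sum_apply, Pi.smul_apply, Module.End.mul_apply, shiftOp_apply,
    MulOpposite.unop_zero, LinearMap.zero_apply, Pi.zero_apply]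
  rw [← this, pow_succ']
  congr 1
  · congr 2
    congr 1
    ring
  · refine Finset.sum_congr rfl fun j _ => ?_
    congr 2
    · congr 1
      ring
    · congr 2
      ring

/-- The representation of the free algebra with `z_{0,h}` acting by `shiftOp` and `z_{1,h}` by zero.
Words act from the right, hence the opposite of the endomorphism ring. -/
noncomputable def freeRep : Free p →ₐ[ZMod p] (Module.End (ZMod p) (ℕ → Milnor p))ᵐᵒᵖ :=
  FreeAlgebra.lift (ZMod p) fun x => if x.1 = 0 then MulOpposite.op (shiftOp p c x.2) else 0

theorem freeRep_zero (h : ℤ) : freeRep p c (zFree p 0 h) = MulOpposite.op (shiftOp p c h) := by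
  simp [freeRep, zFree]

theorem freeRep_one (h : ℤ) : freeRep p c (zFree p 1 h) = 0 := by
  simp [freeRep, zFree]

theorem freeRep_adem [Fact p.Prime] (hp2 : p ≠ 2) {x y : Free p} (h : Adem p x y) :
    freeRep p c x = freeRep p c y := by
  obtain ⟨ε, k, n⟩ | ⟨ε, k, n⟩ := h
  · fin_cases ε
    · simp only [relR, map_add, map_sum, map_smul, map_mul, map_zero, Fin.zero_eta, freeRep_zero]
      exact shiftOp_adem p c hp2 k n
    · simp [relR, freeRep_one]
  · simp [relS, freeRep_one]

/-- The representation of `Q(p)` induced by `freeRep`. -/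
noncomputable def rep [Fact p.Prime] (hp2 : p ≠ 2) :
    Q p →ₐ[ZMod p] (Module.End (ZMod p) (ℕ → Milnor p))ᵐᵒᵖ :=
  RingQuot.liftAlgHom (ZMod p) ⟨freeRep p c, fun _ _ h => freeRep_adem p c hp2 h⟩

theorem rep_z [Fact p.Prime] (hp2 : p ≠ 2) (h : ℤ) :
    rep p c hp2 (z p (0, h)) = MulOpposite.op (shiftOp p c h) := by
  rw [rep, z, RingQuot.liftAlgHom_mkAlgHom_apply, freeRep_zero]

/-- The composite of the operations by which a word acts on the component numbered by its length. -/
noncomputable def wordOp : List ℤ → Milnor p → Milnor p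
  | [], v => v
  | h :: l, v => wordOp l (dInt p (h + (p : ℤ) ^ l.length * c) v)

theorem wordOp_zero (l : List ℤ) : wordOp p c l 0 = 0 := by
  induction l with
  | nil => rfl
  | cons h l ih => rw [wordOp, map_zero, ih]

theorem rep_prod_apply [Fact p.Prime] (hp2 : p ≠ 2) (l : List ℤ) (g : ℕ → Milnor p) :
    (rep p c hp2 (l.map fun h => z p (0, h)).prod).unop g 0 = wordOp p c l (g l.length) := by
  induction l generalizing g with
  | nil => simp [wordOp]
  | cons h l ih =>
    rw [List.map_cons, List.prod_cons, map_mul, MulOpposite.unop_mul, Module.End.mul_apply, ih,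
      rep_z]
    rfl

end Representation

/-! ### Linear independence of the admissible monomials -/

section Triangular

variable (p : ℕ)

/-- The monomial `∏ ξ_i ^ (h_i - p * h_{i+1})`, with `h_{m+1} = 0`, that detects the admissible word
`(h_1, …, h_m)`. -/
noncomputable def testVector : List ℕ → Milnor p
  | [] => 1
  | h :: l => MvPolynomial.X 0 ^ (h - p * l.headD 0) * MvPolynomial.rename Nat.succ (testVector l)

theorem natDegree_mul_le_and_coeff {R : Type*} [CommRing R] {f g : Polynomial R} {m n : ℕ}
    {x y : R} (hf : f.natDegree ≤ m ∧ f.coeff m = x) (hg : g.natDegree ≤ n ∧ g.coeff n = y) :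
    (f * g).natDegree ≤ m + n ∧ (f * g).coeff (m + n) = x * y :=
  ⟨Polynomial.natDegree_mul_le_of_le hf.1 hg.1, by
    rw [Polynomial.coeff_mul_add_eq_of_natDegree_le hf.1 hg.1, hf.2, hg.2]⟩

theorem natDegree_pow_le_and_coeff {R : Type*} [CommRing R] {f : Polynomial R} {m : ℕ}
    {x : R} (hf : f.natDegree ≤ m ∧ f.coeff m = x) (r : ℕ) :
    (f ^ r).natDegree ≤ r * m ∧ (f ^ r).coeff (r * m) = x ^ r :=
  ⟨Polynomial.natDegree_pow_le_of_le r hf.1, by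
    rw [Polynomial.coeff_pow_of_natDegree_le hf.1, hf.2]⟩

theorem coaction_succ_top (hp : 0 < p) (k : ℕ) :
    (coaction p (MvPolynomial.X (k + 1))).natDegree ≤ p ^ (k + 1) ∧
      (coaction p (MvPolynomial.X (k + 1))).coeff (p ^ (k + 1)) = MvPolynomial.X k := by
  rw [coaction_succ]
  constructor
  · compute_degree
  · simp [Polynomial.coeff_C, hp.ne']

theorem coaction_zero_top :
    (coaction p (MvPolynomial.X 0)).natDegree ≤ 1 ∧
      (coaction p (MvPolynomial.X 0)).coeff 1 = 1 := by
  rw [coaction_zero]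
  constructor
  · compute_degree
  · simp

/-- Admissibility of a list of natural numbers. -/
def NatAdm (l : List ℕ) : Prop := l.IsChain fun a b => p * b ≤ a

theorem NatAdm.head_le {p : ℕ} {h : ℕ} {l : List ℕ} (hl : NatAdm p (h :: l)) :
    p * l.headD 0 ≤ h := by
  cases l with
  | nil => simp
  | cons a l => exact (List.isChain_cons_cons.1 hl).1

theorem NatAdm.tail {p : ℕ} {h : ℕ} {l : List ℕ} (hl : NatAdm p (h :: l)) : NatAdm p l :=
  List.IsChain.of_cons hl

/-- The analogue of `coaction_testVector_top` for test vectors whose variables are shifted by `n + 1`,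
as they occur inside the test vectors of longer lists. -/
theorem coaction_rename_testVector_top (hp : 0 < p) {l : List ℕ} (hl : NatAdm p l) (n : ℕ) :
    (coaction p (MvPolynomial.rename (· + (n + 1)) (testVector p l))).natDegree
        ≤ p ^ (n + 1) * l.headD 0 ∧
      (coaction p (MvPolynomial.rename (· + (n + 1)) (testVector p l))).coeff
        (p ^ (n + 1) * l.headD 0) = MvPolynomial.rename (· + n) (testVector p l) := by
  induction l generalizing n with
  | nil => simp [testVector]
  | cons h l ih =>
    have hle := hl.head_le
    have hsucc : ∀ m : ℕ, (fun x => x + m) ∘ Nat.succ = fun x : ℕ => x + (m + 1) := by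
      intro m; funext x; simp; omega
    have := natDegree_mul_le_and_coeff
      (natDegree_pow_le_and_coeff (coaction_succ_top p hp n) (h - p * l.headD 0))
      (ih hl.tail (n + 1))
    have e : (h - p * l.headD 0) * p ^ (n + 1) + p ^ (n + 1 + 1) * l.headD 0
        = p ^ (n + 1) * h := by
      obtain ⟨r, rfl⟩ := Nat.exists_eq_add_of_le hle
      rw [Nat.add_sub_cancel_left]; ring
    rw [e] at this
    simp only [testVector, map_mul, map_pow, MvPolynomial.rename_X, MvPolynomial.rename_rename,
      hsucc, zero_add, List.headD_cons]
    exact this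

/-- The total operation applied to the test vector of `h :: l` has degree `h` in `t`, and its top
coefficient is the test vector of `l`. -/
theorem coaction_testVector_top (hp : 0 < p) {h : ℕ} {l : List ℕ} (hl : NatAdm p (h :: l)) :
    (coaction p (testVector p (h :: l))).natDegree ≤ h ∧
      (coaction p (testVector p (h :: l))).coeff h = testVector p l := by
  have := natDegree_mul_le_and_coeff
    (natDegree_pow_le_and_coeff (coaction_zero_top p) (h - p * l.headD 0))
    (coaction_rename_testVector_top p hp hl.tail 0)
  have hle := hl.head_le
  have hid : MvPolynomial.rename (fun x : ℕ => x + 0) (testVector p l) = testVector p l :=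
    MvPolynomial.rename_id_apply _
  rw [show (h - p * l.headD 0) * 1 + p ^ (0 + 1) * l.headD 0 = h by
    rw [zero_add, pow_one, mul_one]; omega, one_pow, one_mul, hid, ← map_pow, ← map_mul] at this
  exact this

/-- The list with entries `h_i + p ^ (m - i) * c`, in natural numbers (for `c` large, nothing is
truncated). -/
def shiftList (c : ℕ) : List ℤ → List ℕ
  | [] => []
  | h :: l => (h + (p : ℤ) ^ l.length * c).toNat :: shiftList c l

variable {p}

theorem natAdm_shiftList (hp : 0 < p) {c : ℕ} {l : List ℤ} (hl : ChainAdm p l)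
    (hc : ∀ h ∈ l, 0 ≤ h + c) : NatAdm p (shiftList p c l) := by
  induction l with
  | nil => exact List.isChain_nil
  | cons h l ih =>
    cases l with
    | nil => exact List.isChain_singleton _
    | cons b l =>
      refine List.isChain_cons_cons.2 ⟨?_, ih (List.IsChain.of_cons hl)
        fun x hx => hc x (List.mem_cons_of_mem _ hx)⟩
      have h1 : h ≥ p * b := (List.isChain_cons_cons.1 hl).1
      have h2 := hc b (by simp)
      have h3 : (1 : ℤ) ≤ (p : ℤ) ^ l.length := one_le_pow₀ (by omega)
      have h4 : 0 ≤ b + (p : ℤ) ^ l.length * c := by nlinarith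
      zify
      rw [Int.toNat_of_nonneg h4, List.length_cons, pow_succ']
      refine le_trans ?_ (Int.self_le_toNat _)
      linarith

theorem wordOp_testVector_self (hp : 0 < p) {c : ℕ} {l : List ℤ} (hl : ChainAdm p l)
    (hc : ∀ h ∈ l, 0 ≤ h + c) : wordOp p c l (testVector p (shiftList p c l)) = 1 := by
  induction l with
  | nil => rfl
  | cons h l ih =>
    have h3 : (1 : ℤ) ≤ (p : ℤ) ^ l.length := one_le_pow₀ (by omega)
    have h2 := hc h (by simp)
    have h4 : 0 ≤ h + (p : ℤ) ^ l.length * c := by nlinarith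
    have hadm := natAdm_shiftList hp hl hc
    rw [wordOp, dInt, if_pos h4, dNat_apply, shiftList, (coaction_testVector_top p hp hadm).2]
    exact ih (List.IsChain.of_cons hl) fun x hx => hc x (List.mem_cons_of_mem _ hx)

/-- The test vector of `l` is killed by every lexicographically larger word of the same length. -/
theorem wordOp_testVector_of_lt (hp : 0 < p) {c : ℕ} {l l' : List ℤ} (hl : ChainAdm p l)
    (hc : ∀ h ∈ l, 0 ≤ h + c) (hlen : l'.length = l.length) (hlt : l < l') :
    wordOp p c l' (testVector p (shiftList p c l)) = 0 := by
  induction l generalizing l' with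
  | nil =>
    rw [List.length_nil, List.length_eq_zero_iff] at hlen
    subst hlen
    exact absurd hlt (lt_irrefl _)
  | cons h l ih =>
    obtain _ | ⟨h', l'⟩ := l'
    · simp at hlen
    have h3 : (1 : ℤ) ≤ (p : ℤ) ^ l.length := one_le_pow₀ (by omega)
    have h2 := hc h (by simp)
    have h4 : 0 ≤ h + (p : ℤ) ^ l.length * c := by nlinarith
    have hadm := natAdm_shiftList hp hl hc
    have hlen' : l'.length = l.length := by simpa using hlen
    have htop := coaction_testVector_top p hp hadm
    rw [wordOp, hlen']
    rcases List.cons_lt_cons_iff.1 hlt with hh | ⟨rfl, hh⟩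
    · rw [dInt, if_pos (by omega), dNat_apply, shiftList,
        Polynomial.coeff_eq_zero_of_natDegree_lt, wordOp_zero]
      refine htop.1.trans_lt ?_
      omega
    · rw [dInt, if_pos h4, dNat_apply, shiftList, htop.2]
      exact ih (List.IsChain.of_cons hl) (fun x hx => hc x (List.mem_cons_of_mem _ hx)) hlen' hh

/-- The admissible monomials in the `z_{0,h}` are linearly independent in `Q(p)`: in a vanishing linear
combination, the test vector of the lexicographically least label with a nonzero coefficient, placed
in the component numbered by the length, sees only that label. -/
theorem linearIndependent_chainAdm [Fact p.Prime] (hp2 : p ≠ 2) :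
    LinearIndependent (ZMod p)
      fun l : {l : List ℤ // ChainAdm p l} => (l.1.map fun h => z p (0, h)).prod := by
  have hp : 0 < p := (Fact.out : p.Prime).pos
  rw [linearIndependent_iff]
  intro f hf
  by_contra hne
  obtain ⟨⟨l, hl⟩, hmem, hmin⟩ := Finset.exists_min_image f.support (fun l => l.1)
    (Finsupp.support_nonempty_iff.2 hne)
  -- a shift that makes all entries of `l` nonnegative; those of the other labels need not be
  obtain ⟨c, hc⟩ : ∃ c : ℕ, ∀ h ∈ l, 0 ≤ h + c := by
    refine ⟨(l.map Int.natAbs).sum, fun h hh => ?_⟩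
    have := List.single_le_sum (l := l.map Int.natAbs) (by simp) _ (List.mem_map_of_mem hh)
    omega
  set v := testVector p (shiftList p c l) with hv
  have h0 := congrArg (fun x => (rep p c hp2 x).unop (Pi.single l.length v) 0) hf
  simp only [Finsupp.linearCombination_apply, Finsupp.sum, map_sum, map_smul, Finset.unop_sum,
    MulOpposite.unop_smul, LinearMap.sum_apply, LinearMap.smul_apply, Finset.sum_apply,
    Pi.smul_apply, rep_prod_apply, map_zero, MulOpposite.unop_zero, LinearMap.zero_apply,
    Pi.zero_apply] at h0
  rw [Finset.sum_eq_single ⟨l, hl⟩] at h0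
  · rw [Pi.single_eq_same, wordOp_testVector_self hp hl hc, smul_eq_zero] at h0
    exact (Finsupp.mem_support_iff.1 hmem) (h0.resolve_right one_ne_zero)
  · rintro ⟨l', hl'⟩ hmem' hne'
    by_cases hlen : l'.length = l.length
    · rw [hlen, Pi.single_eq_same, wordOp_testVector_of_lt hp hl hc hlen, smul_zero]
      exact lt_of_le_of_ne (hmin _ hmem') fun h => hne' (Subtype.ext h.symm)
    · rw [Pi.single_eq_of_ne hlen, wordOp_zero, smul_zero]
  · intro h
    exact absurd hmem h

end Triangular
/-! ### The subalgebra and its presentation -/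

section Presentation

variable {p : ℕ}

/-- The identity `p * α_s + 1 = p ^ s + α_s`, both sides being `α_{s+1}`. -/
theorem mul_alpha_add_one (hp : 1 < p) (s : ℕ) :
    (p : ℤ) * alpha p s + 1 = (p : ℤ) ^ s + alpha p s := by
  have h : (p - 1) * alpha p s = p ^ s - 1 := by
    refine Nat.mul_div_cancel' ?_
    simpa using Nat.sub_dvd_pow_sub_pow p 1 s
  have h1 : 1 ≤ p ^ s := Nat.one_le_pow _ _ (by omega)
  have h2 := congrArg (Nat.cast (R := ℤ)) h
  push_cast [Nat.cast_sub hp.le, Nat.cast_sub h1] at h2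
  linear_combination h2

theorem admissible_map_idx_iff (hp : 1 < p) (s : ℕ) (l : List ℤ) :
    Admissible p (l.map (idx p s)) ↔ ChainAdm p l := by
  rw [Admissible, ChainAdm, List.isChain_map]
  have hα := mul_alpha_add_one hp s
  have hpow : (0 : ℤ) < (p : ℤ) ^ s := by positivity
  have hα0 : (0 : ℤ) ≤ alpha p s := Int.natCast_nonneg _
  have : (fun a b : ℤ => (idx p s a).2 ≥ p * (idx p s b).2 + ((idx p s b).1.val : ℤ))
      = fun a b : ℤ => a ≥ p * b := by
    funext a b
    simp only [idx, Fin.val_zero, Nat.cast_zero, add_zero, eq_iff_iff]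
    -- `p * (p ^ s * b - α) = p ^ s * (p * b - 1) + 1 - α`, and `a ≥ p * b - 1 + p ^ (-s)`
    -- is the same as `a ≥ p * b` for integers
    have e : (p : ℤ) * (p ^ s * b - alpha p s)
        = p ^ s * (p * b - 1) + 1 - alpha p s := by linear_combination -hα
    rw [e]
    constructor
    · intro h
      have : (p : ℤ) ^ s * (p * b - 1) < p ^ s * a := by linarith
      have := lt_of_mul_lt_mul_left this hpow.le
      omega
    · intro h
      have : (p : ℤ) ^ s * (p * b) ≤ p ^ s * a := by gcongr
      linarith
  rw [this]

/-- The index `(0, p^s h - α_s)` as an element of the set `T p s`. -/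
def gen (p s : ℕ) (h : ℤ) : T p s := ⟨idx p s h, h, rfl⟩

theorem gen_surjective (s : ℕ) : Function.Surjective (gen p s) := by
  rintro ⟨_, h, rfl⟩
  exact ⟨h, rfl⟩

/-- In the generators `z_{0, p^s m - α_s}`, the relation `R(0, p^s h - α_s, p^s n)` has the form of
`R(0, h, n)`. -/
theorem relR_idx [Fact p.Prime] (hp2 : p ≠ 2) (s : ℕ) (h : ℤ) (n : ℕ) :
    relR p 0 ((p : ℤ) ^ s * h - alpha p s) (p ^ s * n)
      = zFree p 0 (idx p s (p * h - 1 - n)).2 * zFree p 0 (idx p s h).2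
        + ∑ j ∈ Finset.range (n + 1), ademCoeff p n j •
          (zFree p 0 (idx p s (p * h - 1 - j)).2 * zFree p 0 (idx p s (h - n + j)).2) := by
  have hα := mul_alpha_add_one (Fact.out : p.Prime).one_lt s
  have e : ∀ j : ℕ, (p : ℤ) * ((p : ℤ) ^ s * h - alpha p s) - 1 - ((p ^ s * j : ℕ) : ℤ)
      = (idx p s (p * h - 1 - j)).2 := by
    intro j
    simp only [idx]
    push_cast
    linear_combination -hα
  rw [relR, e]
  congr 1
  refine (sum_ademCoeff_pow hp2 s n fun j => zFree p 0
    ((p : ℤ) * ((p : ℤ) ^ s * h - alpha p s) - 1 - j) * zFree p 0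
    ((p : ℤ) ^ s * h - alpha p s - ((p ^ s * n : ℕ) : ℤ) + j)).trans ?_
  refine Finset.sum_congr rfl fun j _ => ?_
  rw [e]
  congr 3
  simp only [idx]
  push_cast
  ring

theorem zPres_adem [Fact p.Prime] (hp2 : p ≠ 2) (s : ℕ) :
    SatisfiesAdem p fun h => zPres p s (gen p s h) := by
  intro h n
  have hrel := RingQuot.mkAlgHom_rel (ZMod p) (Adem0.mk (p := p) (s := s)
    (FreeAlgebra.ι (ZMod p) (gen p s (p * h - 1 - n)) * FreeAlgebra.ι (ZMod p) (gen p s h)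
      + ∑ j ∈ Finset.range (n + 1), ademCoeff p n j •
        (FreeAlgebra.ι (ZMod p) (gen p s (p * h - 1 - j))
          * FreeAlgebra.ι (ZMod p) (gen p s (h - n + j)))) h n (by
    rw [relR_idx hp2]
    simp only [map_add, map_mul, map_sum, map_smul, inclFree, FreeAlgebra.lift_ι_apply]
    rfl))
  simp only [map_add, map_mul, map_sum, map_smul, map_zero] at hrel
  exact hrel

theorem adjoin_range_zPres (s : ℕ) : Algebra.adjoin (ZMod p) (Set.range (zPres p s)) = ⊤ := by
  have h : Set.range (zPres p s)
      = RingQuot.mkAlgHom (ZMod p) (Adem0 p s) '' Set.range (FreeAlgebra.ι (ZMod p)) := by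
    rw [← Set.range_comp]; rfl
  rw [h, ← AlgHom.map_adjoin, FreeAlgebra.adjoin_range_ι, Algebra.map_top, AlgHom.range_eq_top]
  exact RingQuot.mkAlgHom_surjective _ _

theorem span_admissible_zPres [Fact p.Prime] (hp2 : p ≠ 2) (s : ℕ) :
    Submodule.span (ZMod p) (Set.range fun I : AdmLabel p s => (I.1.map (zPres p s)).prod) = ⊤ := by
  have hp := (Fact.out : p.Prime).one_lt
  have h := (zPres_adem hp2 s).adjoin_eq_span (zero_lt_one.trans hp)
  have hr : Set.range (fun h => zPres p s (gen p s h)) = Set.range (zPres p s) :=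
    (gen_surjective s).range_comp (zPres p s)
  rw [hr, adjoin_range_zPres, Algebra.top_toSubmodule] at h
  rw [eq_top_iff, h]
  refine Submodule.span_mono ?_
  rintro _ ⟨⟨l, hl⟩, rfl⟩
  refine ⟨⟨l.map (gen p s), ?_⟩, ?_⟩
  · rw [List.map_map]
    exact (admissible_map_idx_iff hp s l).2 hl
  · simp only [List.map_map, Function.comp_def]

theorem linearIndependent_admissible [Fact p.Prime] (hp2 : p ≠ 2) (s : ℕ) :
    LinearIndependent (ZMod p) fun I : AdmLabel p s => (I.1.map fun x => z p x.1).prod := by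
  have h0 : ∀ x : T p s, x.1 = (0, x.1.2) := by
    rintro ⟨_, h, rfl⟩
    rfl
  have hchain : ∀ I : AdmLabel p s, ChainAdm p (I.1.map fun x => x.1.2) := by
    rintro ⟨l, hl⟩
    rw [Admissible, List.isChain_map] at hl
    rw [ChainAdm, List.isChain_map]
    refine hl.imp fun x y hxy => ?_
    rw [h0 y] at hxy
    simpa using hxy
  have hinj : Function.Injective fun I : AdmLabel p s =>
      (⟨I.1.map fun x => x.1.2, hchain I⟩ : {l : List ℤ // ChainAdm p l}) := by
    rintro ⟨l, hl⟩ ⟨l', hl'⟩ h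
    refine Subtype.ext (List.map_injective_iff.2 ?_ (congrArg Subtype.val h))
    intro x y hxy
    refine Subtype.ext ?_
    rw [h0 x, h0 y]
    exact congrArg _ hxy
  convert (linearIndependent_chainAdm hp2).comp _ hinj using 2 with I
  simp only [Function.comp_apply, List.map_map]
  congr 1
  refine List.map_congr_left fun x _ => ?_
  rw [Function.comp_apply, ← h0]

/-- The algebra map from the presented algebra to `Q(p)` given by the obvious map on generators. -/
noncomputable def presHom (p s : ℕ) : Q0Pres p s →ₐ[ZMod p] Q p :=
  RingQuot.liftAlgHom (ZMod p) ⟨(RingQuot.mkAlgHom (ZMod p) (Adem p)).comp (inclFree p s), by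
    intro x y hxy
    cases hxy with
    | mk h n hf =>
      rw [AlgHom.comp_apply, hf, RingQuot.mkAlgHom_rel (ZMod p) (Adem.ofR 0 _ _), map_zero,
        map_zero]⟩

theorem presHom_zPres (s : ℕ) (x : T p s) : presHom p s (zPres p s x) = z p x.1 := by
  rw [presHom, zPres, RingQuot.liftAlgHom_mkAlgHom_apply, AlgHom.comp_apply, inclFree,
    FreeAlgebra.lift_ι_apply, z]

theorem range_presHom (s : ℕ) : (presHom p s).range = Q0 p s := by
  rw [← Algebra.map_top, ← adjoin_range_zPres, AlgHom.map_adjoin, ← Set.range_comp, Q0]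
  congr 1
  rw [Set.image_eq_range]
  congr 1
  funext x
  exact presHom_zPres s x

theorem presHom_prod (s : ℕ) (l : List (T p s)) :
    presHom p s (l.map (zPres p s)).prod = (l.map fun x => z p x.1).prod := by
  rw [map_list_prod, List.map_map]
  congr 1
  exact List.map_congr_left fun x _ => presHom_zPres s x

theorem presHom_injective [Fact p.Prime] (hp2 : p ≠ 2) (s : ℕ) :
    Function.Injective (presHom p s) := by
  rw [injective_iff_map_eq_zero]
  intro x hx
  have hmem : x ∈ (⊤ : Submodule (ZMod p) (Q0Pres p s)) := trivial
  rw [← span_admissible_zPres hp2, Finsupp.mem_span_range_iff_exists_finsupp] at hmem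
  obtain ⟨c, rfl⟩ := hmem
  have hc : c = 0 := by
    refine linearIndependent_iff.1 (linearIndependent_admissible hp2 s) c ?_
    rw [← hx, Finsupp.linearCombination_apply, Finsupp.sum, Finsupp.sum, map_sum]
    refine Finset.sum_congr rfl fun I _ => ?_
    rw [map_smul, presHom_prod]
  rw [hc, Finsupp.sum_zero_index]

/-- The obvious map on generators as an isomorphism from the presented algebra to the subalgebra. -/
noncomputable def presEquiv (p : ℕ) [Fact p.Prime] (hp2 : p ≠ 2) (s : ℕ) :
    Q0Pres p s ≃ₐ[ZMod p] Q0 p s :=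
  (AlgEquiv.ofInjective (presHom p s) (presHom_injective hp2 s)).trans
    (Subalgebra.equivOfEq _ _ (range_presHom s))

theorem coe_presEquiv [Fact p.Prime] (hp2 : p ≠ 2) (s : ℕ) (x : Q0Pres p s) :
    (presEquiv p hp2 s x : Q p) = presHom p s x := rfl

/-- The basis of the presented algebra formed by the admissible monomials. -/
noncomputable def presBasis (p : ℕ) [Fact p.Prime] (hp2 : p ≠ 2) (s : ℕ) :
    Module.Basis (AdmLabel p s) (ZMod p) (Q0Pres p s) :=
  Module.Basis.mk (v := fun I : AdmLabel p s => (I.1.map (zPres p s)).prod)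
    (LinearIndependent.of_comp (presHom p s).toLinearMap (by
      have h : (presHom p s).toLinearMap ∘ (fun I : AdmLabel p s => (I.1.map (zPres p s)).prod)
          = fun I : AdmLabel p s => (I.1.map fun x => z p x.1).prod :=
        funext fun I => presHom_prod s I.1
      rw [h]
      exact linearIndependent_admissible hp2 s))
    (span_admissible_zPres hp2 s).ge

end Presentation
end UnivSteenrod

theorem proposition2p6 (p : ℕ) [Fact p.Prime] (hp : p ≠ 2) (s : ℕ) :
    -- the monic admissible monomials form a basis of the subalgebra
    (∃ b : Module.Basis (UnivSteenrod.AdmLabel p s) (ZMod p) (UnivSteenrod.Q0 p s),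
      ∀ I : UnivSteenrod.AdmLabel p s,
        (b I : UnivSteenrod.Q p) = (I.1.map fun x => UnivSteenrod.z p x.1).prod) ∧
    -- the subalgebra is the algebra presented by the relations `R(0, p^s h - α_s, p^s n) = 0`
    (∃ e : UnivSteenrod.Q0Pres p s ≃ₐ[ZMod p] UnivSteenrod.Q0 p s,
      ∀ x : UnivSteenrod.T p s,
        (e (UnivSteenrod.zPres p s x) : UnivSteenrod.Q p) = UnivSteenrod.z p x.1) ∧
    -- admissibility in terms of `h₁, …, h_m`
    (∀ h : List ℤ,
      UnivSteenrod.Admissible p (h.map (UnivSteenrod.idx p s)) ↔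
        h.IsChain fun a b : ℤ => a ≥ p * b) := by
  refine ⟨⟨(UnivSteenrod.presBasis p hp s).map (UnivSteenrod.presEquiv p hp s).toLinearEquiv,
    fun I => ?_⟩, ⟨UnivSteenrod.presEquiv p hp s, fun x => ?_⟩,
    UnivSteenrod.admissible_map_idx_iff (Fact.out : p.Prime).one_lt s⟩
  · rw [Module.Basis.map_apply, AlgEquiv.toLinearEquiv_apply, UnivSteenrod.coe_presEquiv,
      UnivSteenrod.presBasis, Module.Basis.mk_apply, UnivSteenrod.presHom_prod]
  · rw [UnivSteenrod.coe_presEquiv, UnivSteenrod.presHom_zPres]
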